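/- Let $r\ge 1$ and let factor $k\in\{1,\dots,r\}$ have levels $0,1,\dots,p_k$. Parameter vectors $\beta\in\mathbb R^p$, $p=1+\sum_{k=1}^r p_k$, have blocks $\beta_1=(\beta_{0,1},\dots,\beta_{p_1,1})$ and $\beta_k=(\beta_{1,k},\dots,\beta_{p_k,k})$ for $k\ge 2$; for $k\ge2$ put $\beta_{0,k}=0$. Let $X\in\mathbb R^{n\times p}$ be a fixed matrix with nonzero columns $x_{j,k}$ (dummy-coded factors, and continuous predictors regarded as factors with two levels, are special cases), and let $y=X\mathring\beta+\varepsilon$ with independent $\varepsilon_1,\dots,\varepsilon_n$ satisfying $\mathbb E e^{u\varepsilon_i}\le e^{\sigma^2u^2/2}$ for all $u\in\mathbb R$, where $\sigma>0$. Put $\ell(\beta)=\sum_{i=1}^n[(x_{i\cdot}^T\beta)^2/2-y_ix_{i\cdot}^T\beta]$ and let $W_k$ be the diagonal matrix with entries $(W_k)_{jj}=\|x_{j,k}\|$, $W=\mathrm{diag}(W_1,\dots,W_r)$. Models. A model $M=(P_1,\dots,P_r)$ consists of a partition $P_k$ of $\{0,\dots,p_k\}$ for each $k$. Let $L_M$ be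 the space of all $\beta\in\mathbb R^p$ with $\beta_{i,k}=\beta_{j,k}$ whenever $i,j$ lie in the same cluster of $P_k$; put $|M|=\dim L_M$, and write $M\subsetneq N$ if $L_M\subsetneq L_N$. The true model $T$ merges levels $i,j$ of factor $k$ iff $\mathring\beta_{i,k}=\mathring\beta_{j,k}$. The procedure PDMR with parameter $\lambda\ge0$. (1) Compute a minimizer $\hat\beta$ of $\ell(\beta)+\lambda\sum_{k=1}^r\|W_k\beta_k\|$. (2a) For each $k$ with $\hat\beta_k\ne0$ perform complete linkage clustering of the levels of factor $k$ with dissimilarities $|\hat\beta_{i,k}-\hat\beta_{j,k}|$. Sort the cutting heights of all these clusterings increasingly. Let $M_0$ be the model in which all levels of these factors are distinct and all levels of each remaining factor are merged, and perform the mergings one at a time in the sorted order; this gives a nested family $\mathcal M=\{M_0,M_1,\dots\}$, ending with the model in which all levels of every factor are merged. (2b) Let $\hat M_{PDMR}$ be a minimizer of $\min_{\beta\in L_M}\ell(\beta)+\frac{\lambda^2}{2}|M|$ over $M\in\mathcal M$. Minimizers and ties may be chosen in any way. Constants (an infimum over the empty set is $+\infty$, and $0\cdot\infty=0$). Let $\Delta$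 be the minimum of $|\mathring\beta_{i,k}-\mathring\beta_{j,k}|$ over all $k,i,j$ with $\mathring\beta_{i,k}\ne\mathring\beta_{j,k}$. Let $S=\{k:\mathring\beta_k\ne0\}$, and for $a\in(0,1)$ let $\mathcal C_a$ be the set of $v\in\mathbb R^p$ with $\sum_{k\notin S}\|W_kv_k\|\le\sum_{k\in S}\|W_kv_k\|+a|Wv|_1$, and $$\zeta_a=\inf_{0\ne v\in\mathcal C_a}\frac{|W^{-1}X^TXv|_\infty}{|v|_\infty},\qquad \delta_T=\min_{M\subsetneq T}\frac{\min_{\beta\in L_M}\|X\mathring\beta-X\beta\|^2}{|T|-|M|}.$$ Theorem. If some $a\in(0,1)$ satisfies $$2a^{-2}\sigma^2\log\frac{|T|^2}{2\log2}\le\lambda^2<\frac{\min(\Delta^2\zeta_a^2,\,4\delta_T)}{16(1+a)^2},$$ then $$P\big(\hat M_{PDMR}\subsetneq T\big)\le(2p+|T|^2)\exp\Big(-\frac{a^2\lambda^2}{2\sigma^2}\Big).$$ -/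

import Mathlib

open MeasureTheory ProbabilityTheory
open scoped ENNReal

noncomputable section

namespace PDMR

variable {r n : ℕ} {p : Fin (r + 1) → ℕ}

/-- Coordinates of the parameter vector. Factor `k` has the levels `0, …, p k`; its reference level
`0` carries a coefficient only for the first factor `k = 0` (there it is the intercept). -/
abbrev Coord (p : Fin (r + 1) → ℕ) : Type :=
  {c : (k : Fin (r + 1)) × Fin (p k + 1) // c.1 = 0 ∨ c.2 ≠ 0}

/-- The coefficient of level `j` of factor `k`, where the reference levels of all factors but the
first get the coefficient `0`. -/
def coef (β : Coord p → ℝ) (k : Fin (r + 1)) (j : Fin (p k + 1)) : ℝ :=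
  if h : k = 0 ∨ j ≠ 0 then β ⟨⟨k, j⟩, h⟩ else 0

/-- A model: one partition of the levels of each factor; related levels are merged. -/
abbrev Model (p : Fin (r + 1) → ℕ) : Type :=
  (k : Fin (r + 1)) → Setoid (Fin (p k + 1))

/-- The linear space `L_M` of the parameter vectors that satisfy the constraints of `M`. -/
def modelSpace (M : Model p) : Submodule ℝ (Coord p → ℝ) where
  carrier := {β | ∀ k i j, M k i j → coef β k i = coef β k j}
  zero_mem' := by
    intro k i j _
    simp [coef]
  add_mem' := by
    intro x y hx hy k i j hij
    have h1 := hx k i j hij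
    have h2 := hy k i j hij
    have add : ∀ l, coef (x + y) k l = coef x k l + coef y k l := by
      intro l
      unfold coef
      split <;> simp
    rw [add, add, h1, h2]
  smul_mem' := by
    intro c x hx k i j hij
    have h1 := hx k i j hij
    have smul : ∀ l, coef (c • x) k l = c * coef x k l := by
      intro l
      unfold coef
      split <;> simp
    rw [smul, smul, h1]

/-- The size `|M|`: the dimension of `L_M`. -/
def modelSize (M : Model p) : ℕ := Module.finrank ℝ (modelSpace M)

/-- `M` is a strict submodel of `N`. -/
def StrictSubmodel (M N : Model p) : Prop := modelSpace M < modelSpace N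

/-- The model determined by `β`: two levels of a factor are merged when their coefficients agree. -/
@[reducible] def modelOf (β : Coord p → ℝ) : Model p := fun k => Setoid.ker (coef β k)

/-- The factors with a nonzero block of coefficients. -/
def activeSet (β : Coord p → ℝ) : Set (Fin (r + 1)) :=
  {k | ∃ c : Coord p, c.1.1 = k ∧ β c ≠ 0}

/-! ### Group Lasso -/

/-- The quadratic loss `∑ i, [(xᵢᵀ β)² / 2 - yᵢ xᵢᵀ β]`. -/
def loss (X : Matrix (Fin n) (Coord p) ℝ) (y : Fin n → ℝ) (β : Coord p → ℝ) : ℝ :=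
  ∑ i, ((X.mulVec β i) ^ 2 / 2 - y i * X.mulVec β i)

/-- The default weights: Euclidean norms of the columns of `X`. -/
def weight (X : Matrix (Fin n) (Coord p) ℝ) (c : Coord p) : ℝ := √(∑ i, X i c ^ 2)

/-- The Euclidean norm of the weighted block `W_k v_k`. -/
def blockNorm (w v : Coord p → ℝ) (k : Fin (r + 1)) : ℝ :=
  √(∑ c : Coord p with c.1.1 = k, (w c * v c) ^ 2)

/-- `β` is a Group Lasso estimator with the default weights. -/
def IsGroupLasso (X : Matrix (Fin n) (Coord p) ℝ) (y : Fin n → ℝ) (lam : ℝ)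
    (β : Coord p → ℝ) : Prop :=
  ∀ b : Coord p → ℝ,
    loss X y β + lam * ∑ k, blockNorm (weight X) β k ≤
      loss X y b + lam * ∑ k, blockNorm (weight X) b k

/-! ### Complete linkage clustering and the nested family -/

/-- Complete linkage distance of two clusters of levels with coefficients `b`. -/
def linkage {m : ℕ} (b : Fin m → ℝ) (A B : Set (Fin m)) : ℝ :=
  sSup (Set.image2 (fun i j => |b i - b j|) A B)

/-- One step of complete linkage clustering: two distinct clusters at the smallest distance are
merged, and `h` is that distance (the cutting height). -/
def IsLinkageStep {m : ℕ} (b : Fin m → ℝ) (s t : Setoid (Fin m)) (h : ℝ) : Prop :=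
  ∃ A ∈ s.classes, ∃ B ∈ s.classes, A ≠ B ∧
    (∀ C ∈ s.classes, ∀ D ∈ s.classes, C ≠ D → linkage b A B ≤ linkage b C D) ∧
    (∀ i j, t i j ↔ s i j ∨ (i ∈ A ∪ B ∧ j ∈ A ∪ B)) ∧
    h = linkage b A B

/-- `P 0, P 1, …, P m` are the successive partitions of the `m + 1` levels, from all levels apart
to all levels merged, and `h 0, …, h (m - 1)` the cutting heights, of a complete linkage
clustering. -/
def IsCompleteLinkage {m : ℕ} (b : Fin (m + 1) → ℝ) (P : ℕ → Setoid (Fin (m + 1)))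
    (h : ℕ → ℝ) : Prop :=
  P 0 = ⊥ ∧ ∀ i < m, IsLinkageStep b (P i) (P (i + 1)) (h i)

/-- `F` is a nested family of models built from the estimate `β`. Each active factor is clustered
separately, `e` lists all mergings by increasing cutting height, and the `j`-th model of the family
is obtained by the first `j` mergings of the list; inactive factors are merged completely. -/
def IsNestedFamily (β : Coord p → ℝ) (F : Set (Model p)) : Prop :=
  ∃ (P : (k : Fin (r + 1)) → ℕ → Setoid (Fin (p k + 1))) (h : Fin (r + 1) → ℕ → ℝ),
    (∀ k ∈ activeSet β, IsCompleteLinkage (coef β k) (P k) (h k)) ∧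
    ∃ (N : ℕ) (e : Fin N ≃ {q : (k : Fin (r + 1)) × Fin (p k) // q.1 ∈ activeSet β}),
      Monotone (fun i => h (e i).1.1 (e i).1.2) ∧
      F = {M | ∃ j ≤ N, ∀ k,
        (k ∈ activeSet β →
          M k = P k (Finset.card {i : Fin N | (i : ℕ) < j ∧ (e i).1.1 = k})) ∧
        (k ∉ activeSet β → M k = ⊤)}

/-! ### The selected model -/

/-- `b` is a minimum loss estimator under the constraints of the model `M`. -/
def IsConstrainedEstimator (X : Matrix (Fin n) (Coord p) ℝ) (y : Fin n → ℝ) (M : Model p)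
    (b : Coord p → ℝ) : Prop :=
  b ∈ modelSpace M ∧ ∀ v ∈ modelSpace M, loss X y b ≤ loss X y v

/-- `M` is a possible outcome of PDMR for the data `X, y` and the tuning parameter `lam`: it
minimizes the information criterion over a nested family built from a Group Lasso estimate
(minimizers need not be unique, and ties may be broken in any way). -/
def IsPDMROutput (X : Matrix (Fin n) (Coord p) ℝ) (y : Fin n → ℝ) (lam : ℝ)
    (M : Model p) : Prop :=
  ∃ (β : Coord p → ℝ) (F : Set (Model p)) (b : Model p → Coord p → ℝ),
    IsGroupLasso X y lam β ∧ IsNestedFamily β F ∧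
    (∀ N ∈ F, IsConstrainedEstimator X y N (b N)) ∧
    M ∈ F ∧
    ∀ N ∈ F, loss X y (b M) + lam ^ 2 / 2 * modelSize M ≤
      loss X y (b N) + lam ^ 2 / 2 * modelSize N

/-! ### Characteristics of the true parameter (an infimum over the empty set is `∞`) -/

/-- `Δ`: the smallest gap between distinct coefficients of levels of the same factor. -/
def minGap (β : Coord p → ℝ) : ℝ≥0∞ :=
  ⨅ (k : Fin (r + 1)) (i : Fin (p k + 1)) (j : Fin (p k + 1)) (_ : coef β k i ≠ coef β k j),
    ENNReal.ofReal |coef β k i - coef β k j|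

open Classical in
/-- The cone for the parameter `β`, the constant `a` and the weights `w`. -/
def cone (β : Coord p → ℝ) (a : ℝ) (w : Coord p → ℝ) : Set (Coord p → ℝ) :=
  {v | ∑ k with k ∉ activeSet β, blockNorm w v k ≤
    ∑ k with k ∈ activeSet β, blockNorm w v k + a * ∑ c, |w c * v c|}

/-- `ζ_a`: the cone invertibility factor for the default weights. The norms are sup norms. -/
def cif (X : Matrix (Fin n) (Coord p) ℝ) (β : Coord p → ℝ) (a : ℝ) : ℝ≥0∞ :=
  ⨅ (v : Coord p → ℝ) (_ : v ∈ cone β a (weight X)) (_ : v ≠ 0),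
    ENNReal.ofReal (‖fun c => (weight X c)⁻¹ * (X.transpose * X).mulVec v c‖ / ‖v‖)

/-- The squared distance of `X β` from the space of fits of the model `M`. -/
def fitGap (X : Matrix (Fin n) (Coord p) ℝ) (β : Coord p → ℝ) (M : Model p) : ℝ≥0∞ :=
  ⨅ (v : Coord p → ℝ) (_ : v ∈ modelSpace M),
    ENNReal.ofReal (∑ i, (X.mulVec β i - X.mulVec v i) ^ 2)

/-- `δ_T`: the scaled Kullback-Leibler distance of the model of `β` from its strict submodels. -/
def klGap (X : Matrix (Fin n) (Coord p) ℝ) (β : Coord p → ℝ) : ℝ≥0∞ :=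
  ⨅ (M : Model p) (_ : StrictSubmodel M (modelOf β)),
    fitGap X β M / ((modelSize (modelOf β) - modelSize M : ℕ) : ℝ≥0∞)

end PDMR

end

namespace PDMR

/-! ### Complete linkage clustering -/

/-! The selection of a strict submodel is split according to the noise event `|x_cᵀ ε| ≤ aλ‖x_c‖`
for all columns `c`. Subgaussian tails and a union bound show that it fails with probability at most
`2p q`, where `q = exp (-a²λ²/(2σ²))`.

On this event the argument is deterministic. The Group Lasso error lies in the cone
(`IsGroupLasso.sub_mem_cone`), and the coordinatewise gradient bound together with `ζ_a` makes its
sup norm `e` smaller than a quarter of every gap (`IsGroupLasso.four_mul_norm_lt`). Hence two levels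
are truly equal exactly when their estimates differ by at most `2e`. Complete linkage passes through
any partition defined by such a threshold (`IsCompleteLinkage.eq_of_threshold`), and since one
threshold serves all factors, the true model `T` is in the nested family
(`IsNestedFamily.mem_of_threshold`).

A selected strict submodel `M` therefore has a criterion no larger than that of `T`. By the bound on
`δ_T`, this forces the noise to be at least `aλ√m`, `m = |T| - |M|`, in a fixed unit direction
(`exists_direction`), an event of probability at most `q ^ m`.

The submodels are summed economically: each is labelled by `m` pairs out of `C ≤ |T|²/2` pairs
(`exists_submodel_labels`), so the total is at most `(1 + q) ^ C - 1`. The lower bound on `λ` gives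
`C q ≤ log 2`, which bounds this by `2 C q ≤ |T|² q`. -/

theorem linkage_le_iff {m : ℕ} (b : Fin m → ℝ) {A B : Set (Fin m)} (hA : A.Nonempty)
    (hB : B.Nonempty) {τ : ℝ} :
    linkage b A B ≤ τ ↔ ∀ i ∈ A, ∀ j ∈ B, |b i - b j| ≤ τ := by
  unfold linkage
  rw [csSup_le_iff (Set.toFinite _).bddAbove (hA.image2 hB)]
  exact Set.forall_mem_image2

theorem nonempty_of_mem_classes {α : Type*} {s : Setoid α} {A : Set α} (hA : A ∈ s.classes) :
    A.Nonempty := by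
  obtain ⟨y, rfl⟩ := hA
  exact ⟨y, s.refl y⟩

theorem rel_of_mem_classes {α : Type*} {s : Setoid α} {A : Set α} (hA : A ∈ s.classes) {x y : α}
    (hx : x ∈ A) (hy : y ∈ A) : s x y := by
  obtain ⟨z, rfl⟩ := hA
  exact s.trans hx (s.symm hy)

theorem not_rel_of_mem_classes_of_ne {α : Type*} {s : Setoid α} {A B : Set α}
    (hA : A ∈ s.classes) (hB : B ∈ s.classes) (hAB : A ≠ B) {x y : α} (hx : x ∈ A) (hy : y ∈ B) :
    ¬ s x y := by
  intro h
  apply hAB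
  obtain ⟨z, rfl⟩ := hA
  obtain ⟨w, rfl⟩ := hB
  ext u
  have hzw : s z w := s.trans (s.symm hx) (s.trans h hy)
  exact ⟨fun hu => s.trans hu hzw, fun hu => s.trans hu (s.symm hzw)⟩

namespace IsLinkageStep

variable {m : ℕ} {b : Fin m → ℝ} {s t T : Setoid (Fin m)} {h τ : ℝ}

theorem le (H : IsLinkageStep b s t h) : s ≤ t := by
  obtain ⟨A, -, B, -, -, -, ht, -⟩ := H
  intro i j hij
  exact (ht i j).2 (Or.inl hij)

theorem card_quotient_lt (H : IsLinkageStep b s t h) :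
    Nat.card (Quotient t) < Nat.card (Quotient s) := by
  classical
  have hle := H.le
  obtain ⟨A, hA, B, hB, hAB, -, ht, -⟩ := H
  obtain ⟨x, hx⟩ := nonempty_of_mem_classes hA
  obtain ⟨y, hy⟩ := nonempty_of_mem_classes hB
  let f : Quotient s → Quotient t := Quotient.map' id fun _ _ hij => hle hij
  have hsurj : Function.Surjective f := by
    intro q
    induction q using Quotient.inductionOn with
    | _ u => exact ⟨Quotient.mk s u, rfl⟩
  have hninj : ¬ Function.Injective f := by
    intro hf
    have hxy : f (Quotient.mk s x) = f (Quotient.mk s y) :=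
      Quotient.sound ((ht x y).2 (Or.inr ⟨Or.inl hx, Or.inr hy⟩))
    exact not_rel_of_mem_classes_of_ne hA hB hAB hx hy (Quotient.exact (hf hxy))
  rw [Nat.card_eq_fintype_card, Nat.card_eq_fintype_card]
  exact Fintype.card_lt_of_surjective_not_injective f hsurj hninj

/-- As long as some class of `T` is still split, two of its pieces have linkage at most `τ`, so the
minimal linkage is at most `τ` too. Complete linkage bounds every distance between the merged
clusters, so the merging stays inside a class of `T`. -/
theorem height_le (H : IsLinkageStep b s t h) (hT : ∀ i j, T i j ↔ |b i - b j| ≤ τ)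
    (hs : s ≤ T) (hne : ¬ T ≤ s) : h ≤ τ ∧ t ≤ T := by
  obtain ⟨A, hA, B, hB, hAB, hmin, ht, rfl⟩ := H
  have hAn := nonempty_of_mem_classes hA
  have hBn := nonempty_of_mem_classes hB
  have hlink : linkage b A B ≤ τ := by
    obtain ⟨i, j, hij, hnij⟩ : ∃ i j, T i j ∧ ¬ s i j := by
      by_contra! hcon
      exact hne fun i j hij => hcon i j hij
    have hC := s.mem_classes i
    have hD := s.mem_classes j
    refine (hmin _ hC _ hD fun hCD => hnij ?_).trans ?_
    · exact rel_of_mem_classes hD (hCD ▸ s.refl i) (s.refl j)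
    · rw [linkage_le_iff b (nonempty_of_mem_classes hC) (nonempty_of_mem_classes hD)]
      intro u hu v hv
      exact (hT u v).1 (T.trans (hs hu) (T.trans hij (T.symm (hs hv))))
  refine ⟨hlink, ?_⟩
  rw [linkage_le_iff b hAn hBn] at hlink
  have hTAB : ∀ x ∈ A, ∀ y ∈ B, T x y := fun x hx y hy => (hT x y).2 (hlink x hx y hy)
  intro i j hij
  rcases (ht i j).1 hij with hij | ⟨hi | hi, hj | hj⟩
  · exact hs hij
  · exact hs (rel_of_mem_classes hA hi hj)
  · exact hTAB i hi j hj
  · exact T.symm (hTAB j hj i hi)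
  · exact hs (rel_of_mem_classes hB hi hj)

theorem lt_height (H : IsLinkageStep b s t h) (hT : ∀ i j, T i j ↔ |b i - b j| ≤ τ)
    (hs : T ≤ s) : τ < h := by
  obtain ⟨A, hA, B, hB, hAB, -, -, rfl⟩ := H
  obtain ⟨x, hx⟩ := nonempty_of_mem_classes hA
  obtain ⟨y, hy⟩ := nonempty_of_mem_classes hB
  by_contra! hle
  rw [linkage_le_iff b ⟨x, hx⟩ ⟨y, hy⟩] at hle
  exact not_rel_of_mem_classes_of_ne hA hB hAB hx hy (hs ((hT x y).2 (hle x hx y hy)))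

end IsLinkageStep

/-- A down-closed subset of `Fin N` is the initial segment whose length is its cardinality. -/
theorem lt_card_filter_iff {N : ℕ} {q : Fin N → Prop} [DecidablePred q]
    (hq : ∀ i j, i ≤ j → q j → q i) (i : Fin N) :
    (i : ℕ) < Finset.card {j : Fin N | q j} ↔ q i := by
  constructor
  · intro h
    by_contra hi
    have hsub : ({j : Fin N | q j} : Finset (Fin N)) ⊆ Finset.Iio i := by
      intro j hj
      rw [Finset.mem_filter] at hj
      rw [Finset.mem_Iio]
      by_contra! hij
      exact hi (hq i j hij hj.2)
    have hcard := Finset.card_le_card hsub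
    rw [Fin.card_Iio] at hcard
    omega
  · intro h
    have hsub : Finset.Iic i ⊆ ({j : Fin N | q j} : Finset (Fin N)) := by
      intro j hj
      rw [Finset.mem_Iic] at hj
      simpa using hq j i hj h
    have hcard := Finset.card_le_card hsub
    rw [Fin.card_Iic] at hcard
    omega

/-- If the relation `|b i - b j| ≤ τ` is transitive, then complete linkage clustering passes through
the partition that it defines. -/
theorem IsCompleteLinkage.eq_of_threshold {m : ℕ} {b : Fin (m + 1) → ℝ}
    {P : ℕ → Setoid (Fin (m + 1))} {h : ℕ → ℝ} (H : IsCompleteLinkage b P h)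
    {T : Setoid (Fin (m + 1))} {τ : ℝ} (hT : ∀ i j, T i j ↔ |b i - b j| ≤ τ) :
    P (Finset.card {q : Fin m | h q ≤ τ}) = T := by
  classical
  obtain ⟨h0, hstep⟩ := H
  -- Every step lowers the number of classes, so after `m` steps at most one of the `m + 1` is left.
  have hcard : ∀ i ≤ m, Nat.card (Quotient (P i)) + i ≤ m + 1 := by
    intro i
    induction i with
    | zero =>
      intro _
      have := Nat.card_le_card_of_surjective (Quotient.mk (P 0)) Quotient.mk_surjective
      simpa using this
    | succ i ih =>
      intro hi
      have h1 := ih (by omega)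
      have h2 := (hstep i (by omega)).card_quotient_lt
      omega
  have hlast : T ≤ P m := by
    have h1 := hcard m le_rfl
    have h2 : Nat.card (Quotient (P m)) ≤ 1 := by omega
    rw [Finite.card_le_one_iff_subsingleton] at h2
    intro i j _
    exact Quotient.exact (Subsingleton.elim (Quotient.mk (P m) i) (Quotient.mk (P m) j))
  have hex : ∃ i, T ≤ P i := ⟨m, hlast⟩
  -- `c` is the first time at which the classes of `T` are completed. Heights before it are at most
  -- `τ` and heights from it on exceed `τ`, so counting them recovers `c`; monotonicity of the
  -- heights within a factor is not needed.
  set c := Nat.find hex with hc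
  have hcm : c ≤ m := Nat.find_min' hex hlast
  have hbefore : ∀ i ≤ c, P i ≤ T := by
    intro i
    induction i with
    | zero => intro _; rw [h0]; exact bot_le
    | succ i ih =>
      intro hi
      exact ((hstep i (by omega)).height_le hT (ih (by omega)) (Nat.find_min hex (by omega))).2
  have hafter : ∀ i, c ≤ i → i ≤ m → T ≤ P i := by
    intro i hi
    induction i, hi using Nat.le_induction with
    | base => intro _; exact Nat.find_spec hex
    | succ i hi ih =>
      intro him
      exact (ih (by omega)).trans (hstep i (by omega)).le
  have hiff : ∀ q : Fin m, h q ≤ τ ↔ (q : ℕ) < c := by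
    intro q
    constructor
    · intro hq
      by_contra! hcq
      exact absurd ((hstep q q.2).lt_height hT (hafter q hcq q.2.le)) (not_lt.2 hq)
    · intro hq
      exact ((hstep q q.2).height_le hT (hbefore q hq.le) (Nat.find_min hex hq)).1
  have hcount : Finset.card {q : Fin m | h q ≤ τ} = c := by
    simp_rw [hiff]
    rw [Fin.card_filter_val_lt]
    omega
  rw [hcount]
  exact le_antisymm (hbefore c le_rfl) (Nat.find_spec hex)

/-- A model that merges two levels exactly when their estimated coefficients are at distance at
most `τ` belongs to every nested family built from the estimate. -/
theorem IsNestedFamily.mem_of_threshold {r : ℕ} {p : Fin (r + 1) → ℕ} {β : Coord p → ℝ}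
    {F : Set (Model p)} (HF : IsNestedFamily β F) {T : Model p} {τ : ℝ} (hτ : 0 ≤ τ)
    (hT : ∀ k i j, T k i j ↔ |coef β k i - coef β k j| ≤ τ) : T ∈ F := by
  classical
  obtain ⟨P, h, hP, N, e, hmono, rfl⟩ := HF
  have hlt := lt_card_filter_iff (q := fun i : Fin N => h (e i).1.1 (e i).1.2 ≤ τ)
    fun i j hij hj => (hmono hij).trans hj
  -- The list is sorted, so its first `j` mergings, for this `j`, are exactly those of height at
  -- most `τ`. Within factor `k` their number is the index in `eq_of_threshold`.
  refine ⟨Finset.card {i : Fin N | h (e i).1.1 (e i).1.2 ≤ τ}, ?_,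
    fun k => ⟨fun hk => ?_, fun hk => ?_⟩⟩
  · exact (Finset.card_le_univ _).trans (by simp)
  · rw [← (hP k hk).eq_of_threshold (hT k)]
    congr 1
    simp_rw [hlt]
    refine Finset.card_bij (fun q _ => e.symm ⟨⟨k, q⟩, hk⟩) ?_ ?_ ?_
    · intro q hq
      rw [Finset.mem_filter] at hq ⊢
      refine ⟨Finset.mem_univ _, ?_⟩
      rw [Equiv.apply_symm_apply]
      exact ⟨hq.2, rfl⟩
    · intro q₁ _ q₂ _ hq
      simpa using hq
    · intro i hi
      obtain ⟨q, hq⟩ : ∃ q, e i = q := ⟨_, rfl⟩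
      obtain ⟨⟨k', l⟩, hk'⟩ := q
      simp only [Finset.mem_filter, Finset.mem_univ, true_and, hq] at hi
      obtain ⟨h1, rfl⟩ := hi
      rw [hq] at h1
      exact ⟨l, by simpa using h1, by simp [← hq]⟩
  -- All estimates of an inactive factor vanish, so `0 ≤ τ` makes `T` merge all its levels, as the
  -- family does.
  · have hzero : ∀ i, coef β k i = 0 := by
      intro i
      unfold coef
      split_ifs with hi
      · by_contra hne
        exact hk ⟨_, rfl, hne⟩
      · rfl
    ext i j
    simp [hT, hzero, hτ]

/-! ### Deterministic bounds for the Group Lasso -/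

section Lasso

variable {r n : ℕ} {p : Fin (r + 1) → ℕ}

theorem loss_add (X : Matrix (Fin n) (Coord p) ℝ) (y : Fin n → ℝ) (β v : Coord p → ℝ) :
    loss X y (β + v) = loss X y β + ∑ i, (X.mulVec β i - y i) * X.mulVec v i +
      (∑ i, X.mulVec v i ^ 2) / 2 := by
  unfold loss
  rw [Finset.sum_div, ← Finset.sum_add_distrib, ← Finset.sum_add_distrib, Matrix.mulVec_add]
  refine Finset.sum_congr rfl fun i _ => ?_
  rw [Pi.add_apply]
  ring

theorem sum_mul_mulVec (X : Matrix (Fin n) (Coord p) ℝ) (z : Fin n → ℝ) (v : Coord p → ℝ) :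
    ∑ i, z i * X.mulVec v i = ∑ c, X.transpose.mulVec z c * v c := by
  have h := Matrix.dotProduct_mulVec z X v
  rw [← Matrix.mulVec_transpose] at h
  exact h

theorem weight_pos {X : Matrix (Fin n) (Coord p) ℝ} {c : Coord p} (hX : ∃ i, X i c ≠ 0) :
    0 < weight X c := by
  obtain ⟨i, hi⟩ := hX
  exact Real.sqrt_pos.2 (Finset.sum_pos' (fun _ _ => sq_nonneg _)
    ⟨i, Finset.mem_univ _, by positivity⟩)

theorem weight_nonneg (X : Matrix (Fin n) (Coord p) ℝ) (c : Coord p) : 0 ≤ weight X c :=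
  Real.sqrt_nonneg _

theorem weight_sq (X : Matrix (Fin n) (Coord p) ℝ) (c : Coord p) :
    weight X c ^ 2 = ∑ i, X i c ^ 2 :=
  Real.sq_sqrt (Finset.sum_nonneg fun _ _ => sq_nonneg _)

theorem blockNorm_eq_norm (w v : Coord p → ℝ) (k : Fin (r + 1)) :
    blockNorm w v k =
      ‖WithLp.toLp 2 (fun c : Coord p => if c.1.1 = k then w c * v c else 0)‖ := by
  rw [EuclideanSpace.norm_eq, blockNorm, Finset.sum_filter]
  congr 1
  refine Finset.sum_congr rfl fun c _ => ?_
  by_cases hc : c.1.1 = k <;> simp [hc, mul_pow]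

theorem blockNorm_add_le (w u v : Coord p → ℝ) (k : Fin (r + 1)) :
    blockNorm w (u + v) k ≤ blockNorm w u k + blockNorm w v k := by
  simp only [blockNorm_eq_norm]
  refine le_of_eq_of_le ?_ (norm_add_le _ _)
  congr 1
  ext c
  by_cases hc : c.1.1 = k <;> simp [hc, mul_add]

theorem blockNorm_neg (w v : Coord p → ℝ) (k : Fin (r + 1)) :
    blockNorm w (-v) k = blockNorm w v k := by
  simp [blockNorm]

theorem blockNorm_congr {w u v : Coord p → ℝ} {k : Fin (r + 1)}
    (h : ∀ c : Coord p, c.1.1 = k → u c = v c) : blockNorm w u k = blockNorm w v k := by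
  unfold blockNorm
  congr 1
  refine Finset.sum_congr rfl fun c hc => ?_
  rw [h c (Finset.mem_filter.1 hc).2]

theorem blockNorm_single (w : Coord p → ℝ) (c : Coord p) (t : ℝ) (k : Fin (r + 1)) :
    blockNorm w (Pi.single c t) k = if k = c.1.1 then |w c * t| else 0 := by
  unfold blockNorm
  rw [Finset.sum_filter, Finset.sum_eq_single c]
  · by_cases hc : c.1.1 = k
    · simp [hc, Real.sqrt_sq_eq_abs]
    · simp [hc, Ne.symm hc]
  · intro d _ hd
    simp [Pi.single_eq_of_ne hd]
  · simp

theorem sum_blockNorm_single (w : Coord p → ℝ) (c : Coord p) (t : ℝ) :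
    ∑ k, blockNorm w (Pi.single c t) k = |w c * t| := by
  simp [blockNorm_single]

theorem abs_le_of_forall_quadratic_nonneg {g l q : ℝ} (hq : 0 ≤ q)
    (h : ∀ t : ℝ, 0 ≤ t * g + t ^ 2 * q / 2 + |t| * l) : |g| ≤ l := by
  have key : ∀ g' : ℝ, (∀ t : ℝ, 0 ≤ t → 0 ≤ -(t * g') + t ^ 2 * q / 2 + t * l) → g' ≤ l := by
    intro g' h'
    by_contra! hlt
    have hd : 0 < g' - l := by linarith
    -- The minimizer of the quadratic would be `(g' - l) / q`; the `+ 1` covers `q = 0`.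
    have hs : 0 < (g' - l) / (q + 1) := by positivity
    have h1 := h' _ hs.le
    set s := (g' - l) / (q + 1) with hsdef
    have h2 : s * (q + 1) = g' - l := by rw [hsdef]; field_simp
    have h3 : -(s * g') + s ^ 2 * q / 2 + s * l = -(s ^ 2 * (q / 2 + 1)) := by
      have h4 : g' = l + s * (q + 1) := by linarith
      rw [h4]; ring
    rw [h3] at h1
    have : 0 < s ^ 2 * (q / 2 + 1) := by positivity
    linarith
  rw [abs_le]
  constructor
  · have := key (-g) fun t ht => by
      have := h t
      rw [abs_of_nonneg ht] at this
      linarith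
    linarith
  · refine key g fun t ht => ?_
    have := h (-t)
    rw [abs_neg, abs_of_nonneg ht] at this
    linarith [this, neg_sq t, neg_mul t g]

/-- The stationarity condition of the Group Lasso, coordinate by coordinate. -/
theorem IsGroupLasso.abs_gradient_le {X : Matrix (Fin n) (Coord p) ℝ} {y : Fin n → ℝ} {lam : ℝ}
    {β : Coord p → ℝ} (H : IsGroupLasso X y lam β) (hlam : 0 ≤ lam) (c : Coord p) :
    |X.transpose.mulVec (fun i => X.mulVec β i - y i) c| ≤ lam * weight X c := by
  refine abs_le_of_forall_quadratic_nonneg (q := weight X c ^ 2) (sq_nonneg _) fun t => ?_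
  have h1 := H (β + Pi.single c t)
  rw [loss_add, sum_mul_mulVec] at h1
  have h2 : ∑ d, X.transpose.mulVec (fun i => X.mulVec β i - y i) d *
      (Pi.single c t : Coord p → ℝ) d =
      X.transpose.mulVec (fun i => X.mulVec β i - y i) c * t := by
    rw [Finset.sum_eq_single c] <;> simp +contextual
  have h3 : ∑ i, X.mulVec (Pi.single c t) i ^ 2 = t ^ 2 * weight X c ^ 2 := by
    rw [weight_sq, Finset.mul_sum]
    refine Finset.sum_congr rfl fun i _ => ?_
    rw [Matrix.mulVec_single]
    simp
    ring
  -- The triangle inequality bounds the change of the penalty along one coordinate, so no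
  -- subgradients of the block norms are needed.
  have h4 : ∑ k, blockNorm (weight X) (β + Pi.single c t) k ≤
      ∑ k, blockNorm (weight X) β k + weight X c * |t| := by
    have h5 : weight X c * |t| = ∑ k, blockNorm (weight X) (Pi.single c t) k := by
      rw [sum_blockNorm_single, abs_mul, abs_of_nonneg (weight_nonneg X c)]
    rw [h5, ← Finset.sum_add_distrib]
    exact Finset.sum_le_sum fun k _ => blockNorm_add_le _ _ _ k
  rw [h2, h3] at h1
  have h6 := mul_le_mul_of_nonneg_left h4 hlam
  rw [mul_add] at h6
  linarith [mul_comm (X.transpose.mulVec (fun i => X.mulVec β i - y i) c) t,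
    mul_comm (weight X c) |t|, mul_left_comm lam (weight X c) |t|,
    mul_left_comm lam |t| (weight X c)]

variable {X : Matrix (Fin n) (Coord p) ℝ} {β₀ β : Coord p → ℝ} {ε : Fin n → ℝ} {lam a : ℝ}

theorem transpose_mulVec_residual (X : Matrix (Fin n) (Coord p) ℝ) (β₀ β : Coord p → ℝ)
    (ε : Fin n → ℝ) (c : Coord p) :
    X.transpose.mulVec (fun i => X.mulVec β i - (X.mulVec β₀ i + ε i)) c =
      (X.transpose * X).mulVec (β - β₀) c - X.transpose.mulVec ε c := by
  have h : (fun i => X.mulVec β i - (X.mulVec β₀ i + ε i)) = X.mulVec (β - β₀) - ε := by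
    ext i
    simp [Matrix.mulVec_sub]
    ring
  rw [h, Matrix.mulVec_sub, Matrix.mulVec_mulVec]
  rfl

/-- When the noise is dominated by the penalty, the estimation error of the Group Lasso lies in the
cone. -/
theorem IsGroupLasso.sub_mem_cone
    (H : IsGroupLasso X (fun i => X.mulVec β₀ i + ε i) lam β) (hlam : 0 < lam)
    (hε : ∀ c, |X.transpose.mulVec ε c| ≤ a * lam * weight X c) :
    β - β₀ ∈ cone β₀ a (weight X) := by
  classical
  set v := β - β₀ with hv
  have hβ : β = β₀ + v := by rw [hv]; abel
  have h1 := H β₀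
  have h2 : ∑ i, (X.mulVec β₀ i - (X.mulVec β₀ i + ε i)) * X.mulVec v i =
      -∑ c, X.transpose.mulVec ε c * v c := by
    rw [← sum_mul_mulVec, ← Finset.sum_neg_distrib]
    exact Finset.sum_congr rfl fun i _ => by ring
  have h3 : ∑ c, X.transpose.mulVec ε c * v c ≤ lam * (a * ∑ c, |weight X c * v c|) := by
    rw [Finset.mul_sum, Finset.mul_sum]
    refine Finset.sum_le_sum fun c _ => ?_
    refine (le_abs_self _).trans ?_
    rw [abs_mul, abs_mul, abs_of_nonneg (weight_nonneg X c)]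
    refine (mul_le_mul_of_nonneg_right (hε c) (abs_nonneg _)).trans_eq ?_
    ring
  have h4 : (0 : ℝ) ≤ (∑ i, X.mulVec v i ^ 2) / 2 := by positivity
  have hloss := loss_add X (fun i => X.mulVec β₀ i + ε i) β₀ v
  rw [← hβ, h2] at hloss
  -- Optimality of `β` against `β₀`, with the nonnegative quadratic term dropped.
  have h5 : lam * ∑ k, blockNorm (weight X) β k ≤
      lam * (∑ k, blockNorm (weight X) β₀ k + a * ∑ c, |weight X c * v c|) := by
    rw [mul_add]
    linarith
  have h6 := le_of_mul_le_mul_left h5 hlam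
  rw [← Finset.sum_filter_add_sum_filter_not _ (fun k => k ∈ activeSet β₀)
      (fun k => blockNorm (weight X) β k),
    ← Finset.sum_filter_add_sum_filter_not _ (fun k => k ∈ activeSet β₀)
      (fun k => blockNorm (weight X) β₀ k)] at h6
  have hzero : ∀ k, k ∉ activeSet β₀ → ∀ c : Coord p, c.1.1 = k → β₀ c = 0 := by
    intro k hk c hc
    by_contra hne
    exact hk ⟨c, hc, hne⟩
  have h7 : ∑ k with k ∉ activeSet β₀, blockNorm (weight X) β k =
      ∑ k with k ∉ activeSet β₀, blockNorm (weight X) v k := by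
    refine Finset.sum_congr rfl fun k hk => blockNorm_congr fun c hc => ?_
    simp [hv, hzero k (Finset.mem_filter.1 hk).2 c hc]
  have h8 : ∑ k with k ∉ activeSet β₀, blockNorm (weight X) β₀ k = 0 := by
    refine Finset.sum_eq_zero fun k hk => ?_
    rw [blockNorm_congr (v := 0) (hzero k (Finset.mem_filter.1 hk).2)]
    simp [blockNorm]
  have h9 : ∑ k with k ∈ activeSet β₀, blockNorm (weight X) β₀ k ≤
      ∑ k with k ∈ activeSet β₀, blockNorm (weight X) β k +
        ∑ k with k ∈ activeSet β₀, blockNorm (weight X) v k := by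
    rw [← Finset.sum_add_distrib]
    refine Finset.sum_le_sum fun k _ => ?_
    rw [← blockNorm_neg _ v]
    refine le_of_eq_of_le ?_ (blockNorm_add_le _ _ _ k)
    rw [hβ, add_neg_cancel_right]
  change ∑ k with k ∉ activeSet β₀, blockNorm (weight X) v k ≤
    ∑ k with k ∈ activeSet β₀, blockNorm (weight X) v k + a * ∑ c, |weight X c * v c|
  rw [h7, h8] at h6
  linarith

/-- When the noise is dominated by the penalty, the error of the Group Lasso is smaller than a
quarter of every gap between distinct coefficients of a factor. -/
theorem IsGroupLasso.four_mul_norm_lt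
    (H : IsGroupLasso X (fun i => X.mulVec β₀ i + ε i) lam β) (hlam : 0 < lam) (ha : 0 < a)
    (hX : ∀ c, ∃ i, X i c ≠ 0)
    (hε : ∀ c, |X.transpose.mulVec ε c| ≤ a * lam * weight X c)
    (hgap : ENNReal.ofReal (lam ^ 2) * ENNReal.ofReal (16 * (1 + a) ^ 2) <
      minGap β₀ ^ 2 * cif X β₀ a ^ 2)
    {k : Fin (r + 1)} {i j : Fin (p k + 1)} (hij : coef β₀ k i ≠ coef β₀ k j) :
    4 * ‖β - β₀‖ < |coef β₀ k i - coef β₀ k j| := by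
  set v := β - β₀ with hv
  set d := |coef β₀ k i - coef β₀ k j| with hd
  have hdpos : 0 < d := abs_pos.2 (sub_ne_zero.2 hij)
  by_cases hv0 : v = 0
  · simpa [hv0] using hdpos
  have hvpos : 0 < ‖v‖ := norm_pos_iff.2 hv0
  set z : Coord p → ℝ := fun c => (weight X c)⁻¹ * (X.transpose * X).mulVec v c with hz
  have hzle : ‖z‖ ≤ (1 + a) * lam := by
    refine (pi_norm_le_iff_of_nonneg (by positivity)).2 fun c => ?_
    have hw := weight_pos (hX c)
    have h1 := H.abs_gradient_le hlam.le c
    rw [transpose_mulVec_residual] at h1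
    have h2 : |(X.transpose * X).mulVec v c| ≤ (1 + a) * lam * weight X c := by
      have h3 := abs_sub_abs_le_abs_sub ((X.transpose * X).mulVec v c) (X.transpose.mulVec ε c)
      have h4 := hε c
      linarith
    rw [hz, Real.norm_eq_abs, abs_mul, abs_of_pos (inv_pos.2 hw), inv_mul_le_iff₀ hw]
    linarith
  have h1 : minGap β₀ ≤ ENNReal.ofReal d :=
    iInf_le_of_le k <| iInf_le_of_le i <| iInf_le_of_le j <| iInf_le_of_le hij le_rfl
  have h2 : cif X β₀ a ≤ ENNReal.ofReal (‖z‖ / ‖v‖) :=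
    iInf_le_of_le v <| iInf_le_of_le (H.sub_mem_cone hlam hε) <| iInf_le_of_le hv0 le_rfl
  have h3 := hgap.trans_le (mul_le_mul' (pow_le_pow_left' h1 2) (pow_le_pow_left' h2 2))
  rw [← ENNReal.ofReal_pow hdpos.le, ← ENNReal.ofReal_pow (by positivity),
    ← ENNReal.ofReal_mul (by positivity), ← ENNReal.ofReal_mul (by positivity),
    ENNReal.ofReal_lt_ofReal_iff_of_nonneg (by positivity)] at h3
  -- This is `4(1+a)λ < d‖z‖/‖v‖` squared. Since `‖z‖ ≤ (1+a)λ`, the factor `(1+a)λ` cancels and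
  -- leaves `4‖v‖ < d`.
  have h4 : (4 * ((1 + a) * lam)) ^ 2 < (d * (‖z‖ / ‖v‖)) ^ 2 := by
    calc _ = lam ^ 2 * (16 * (1 + a) ^ 2) := by ring
      _ < _ := h3
      _ = _ := by ring
  have h5 := lt_of_pow_lt_pow_left₀ 2 (by positivity) h4
  rw [← mul_div_assoc, lt_div_iff₀ hvpos] at h5
  have h6 : d * ‖z‖ ≤ d * ((1 + a) * lam) := mul_le_mul_of_nonneg_left hzle hdpos.le
  have h7 : (4 * ‖v‖) * ((1 + a) * lam) < d * ((1 + a) * lam) := by linarith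
  exact lt_of_mul_lt_mul_right h7 (by positivity)

theorem abs_coef_sub_coef_le (β β₀ : Coord p → ℝ) (k : Fin (r + 1)) (i : Fin (p k + 1)) :
    |coef β k i - coef β₀ k i| ≤ ‖β - β₀‖ := by
  unfold coef
  split_ifs with h
  · exact norm_le_pi_norm (β - β₀) ⟨⟨k, i⟩, h⟩
  · simp

/-- Each coefficient moves by at most `e = ‖β - β₀‖`: equal ones end at most `2e` apart, while
distinct ones, more than `4e` apart, stay more than `2e` apart. -/
theorem modelOf_iff_of_four_mul_norm_lt
    (h : ∀ (k : Fin (r + 1)) (i j : Fin (p k + 1)), coef β₀ k i ≠ coef β₀ k j →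
      4 * ‖β - β₀‖ < |coef β₀ k i - coef β₀ k j|) (k : Fin (r + 1)) (i j : Fin (p k + 1)) :
    modelOf β₀ k i j ↔ |coef β k i - coef β k j| ≤ 2 * ‖β - β₀‖ := by
  have hi := abs_le.1 (abs_coef_sub_coef_le β β₀ k i)
  have hj := abs_le.1 (abs_coef_sub_coef_le β β₀ k j)
  constructor
  · intro hij
    have hij' : coef β₀ k i = coef β₀ k j := hij
    rw [abs_le]
    constructor <;> linarith
  · intro hle
    by_contra hij
    have h1 := h k i j hij
    have h2 : |coef β₀ k i - coef β₀ k j| ≤ 4 * ‖β - β₀‖ := by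
      rw [abs_le] at hle ⊢
      constructor <;> linarith
    linarith

end Lasso

/-! ### Selection of a strict submodel forces a large deviation of the noise -/

section Selection

variable {r n : ℕ} {p : Fin (r + 1) → ℕ}

theorem exists_orthogonal_residual (X : Matrix (Fin n) (Coord p) ℝ) (β : Coord p → ℝ)
    (V : Submodule ℝ (Coord p → ℝ)) :
    ∃ v ∈ V, ∀ u ∈ V, ∑ i, (X.mulVec β i - X.mulVec v i) * X.mulVec u i = 0 := by
  let L : (Coord p → ℝ) →ₗ[ℝ] EuclideanSpace ℝ (Fin n) :=
    (WithLp.linearEquiv 2 ℝ (Fin n → ℝ)).symm.toLinearMap ∘ₗ X.mulVecLin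
  have hL : ∀ u i, L u i = X.mulVec u i := fun _ _ => rfl
  let W := V.map L
  obtain ⟨v, hv, hvW⟩ := Submodule.mem_map.1 (W.starProjection_apply_mem (L β))
  refine ⟨v, hv, fun u hu => ?_⟩
  have h := W.sub_starProjection_mem_orthogonal (L β)
  rw [← hvW] at h
  have h1 := (Submodule.mem_orthogonal W _).1 h (L u) (Submodule.mem_map_of_mem hu)
  rw [PiLp.inner_apply] at h1
  simpa [hL] using h1

variable {X : Matrix (Fin n) (Coord p) ℝ} {β₀ : Coord p → ℝ} {lam a : ℝ}

theorem mem_modelSpace_modelOf (β : Coord p → ℝ) : β ∈ modelSpace (modelOf β) :=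
  fun _ _ _ h => h

theorem StrictSubmodel.modelSize_lt {M N : Model p} (h : StrictSubmodel M N) :
    modelSize M < modelSize N :=
  Submodule.finrank_lt_finrank_of_lt h

/-- If the minimal loss over the submodel `M` exceeds that over `T` by at most `D / 2`, then the
squared projection of the response on a fit of `T` that is orthogonal to the fits of `M` is at most
`D`. -/
theorem sq_sum_le_of_loss {y : Fin n → ℝ} {M T : Model p} {bM bT γ : Coord p → ℝ}
    (hMT : modelSpace M ≤ modelSpace T) (hbM : IsConstrainedEstimator X y M bM)
    (hbT : IsConstrainedEstimator X y T bT) (hγ : γ ∈ modelSpace T)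
    (horth : ∀ u ∈ modelSpace M, ∑ i, X.mulVec γ i * X.mulVec u i = 0)
    (hpos : 0 < ∑ i, X.mulVec γ i ^ 2) {D : ℝ} (hD : loss X y bM ≤ loss X y bT + D / 2) :
    (∑ i, X.mulVec γ i * y i) ^ 2 ≤ D * ∑ i, X.mulVec γ i ^ 2 := by
  set G := ∑ i, X.mulVec γ i ^ 2 with hG
  set s := ∑ i, X.mulVec γ i * y i with hs
  -- The competitor minimizes the loss on the line through `bM` in direction `γ`, which lowers it by
  -- `s² / (2G)`.
  have h1 := hbT.2 (bM + (s / G) • γ) (add_mem (hMT hbM.1) (Submodule.smul_mem _ _ hγ))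
  rw [loss_add, Matrix.mulVec_smul] at h1
  have h2 : ∑ i, (X.mulVec bM i - y i) * ((s / G) • X.mulVec γ) i = -(s / G * s) := by
    have h3 : ∀ i, (X.mulVec bM i - y i) * ((s / G) • X.mulVec γ) i =
        s / G * (X.mulVec γ i * X.mulVec bM i) - s / G * (X.mulVec γ i * y i) := by
      intro i
      rw [Pi.smul_apply, smul_eq_mul]
      ring
    simp_rw [h3]
    rw [Finset.sum_sub_distrib, ← Finset.mul_sum, ← Finset.mul_sum, horth bM hbM.1]
    ring
  have h4 : ∑ i, ((s / G) • X.mulVec γ) i ^ 2 = (s / G) ^ 2 * G := by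
    rw [hG, Finset.mul_sum]
    exact Finset.sum_congr rfl fun i _ => by rw [Pi.smul_apply, smul_eq_mul, mul_pow]
  rw [h2, h4] at h1
  have h5 : (s / G) ^ 2 * G = s ^ 2 / G := by field_simp
  have h6 : s / G * s = s ^ 2 / G := by ring
  rw [h5, h6] at h1
  rw [← div_le_iff₀ hpos]
  linarith

theorem lt_sum_sq_of_lt_klGap {M : Model p} (hM : StrictSubmodel M (modelOf β₀))
    (hgap : ENNReal.ofReal (lam ^ 2) * ENNReal.ofReal (16 * (1 + a) ^ 2) < 4 * klGap X β₀)
    {v : Coord p → ℝ} (hv : v ∈ modelSpace M) :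
    4 * (1 + a) ^ 2 * lam ^ 2 * ((modelSize (modelOf β₀) - modelSize M : ℕ) : ℝ) <
      ∑ i, (X.mulVec β₀ i - X.mulVec v i) ^ 2 := by
  set m := modelSize (modelOf β₀) - modelSize M with hm
  have hmpos : 0 < m := Nat.sub_pos_of_lt hM.modelSize_lt
  set G := ∑ i, (X.mulVec β₀ i - X.mulVec v i) ^ 2 with hG
  have hG0 : 0 ≤ G := Finset.sum_nonneg fun _ _ => sq_nonneg _
  have h1 : klGap X β₀ ≤ ENNReal.ofReal G / (m : ℝ≥0∞) :=
    iInf_le_of_le M <| iInf_le_of_le hM <| ENNReal.div_le_div_right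
      (iInf_le_of_le v <| iInf_le_of_le hv le_rfl) _
  have hmR : (0 : ℝ) < m := by exact_mod_cast hmpos
  have h2 := hgap.trans_le (mul_le_mul' (le_refl (4 : ℝ≥0∞)) h1)
  have h3 : (4 : ℝ≥0∞) * (ENNReal.ofReal G / (m : ℝ≥0∞)) = ENNReal.ofReal (4 * (G / m)) := by
    rw [ENNReal.ofReal_mul (by norm_num), ENNReal.ofReal_div_of_pos hmR, ENNReal.ofReal_natCast]
    simp
  rw [h3, ← ENNReal.ofReal_mul (by positivity),
    ENNReal.ofReal_lt_ofReal_iff_of_nonneg (by positivity), ← mul_div_assoc, lt_div_iff₀ hmR] at h2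
  linarith

/-- There is a unit vector such that the criterion can prefer `M` to the true model only if the
noise is large in this direction. -/
theorem exists_direction {M : Model p} (hM : StrictSubmodel M (modelOf β₀)) (ha : 0 ≤ a)
    (hlam : 0 ≤ lam)
    (hgap : ENNReal.ofReal (lam ^ 2) * ENNReal.ofReal (16 * (1 + a) ^ 2) < 4 * klGap X β₀) :
    ∃ u : Fin n → ℝ, ∑ i, u i ^ 2 = 1 ∧
      ∀ (ε : Fin n → ℝ) (M' : Model p) (bM bT : Coord p → ℝ), modelSpace M' = modelSpace M →
        IsConstrainedEstimator X (fun i => X.mulVec β₀ i + ε i) M' bM →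
        IsConstrainedEstimator X (fun i => X.mulVec β₀ i + ε i) (modelOf β₀) bT →
        loss X (fun i => X.mulVec β₀ i + ε i) bM + lam ^ 2 / 2 * modelSize M' ≤
          loss X (fun i => X.mulVec β₀ i + ε i) bT + lam ^ 2 / 2 * modelSize (modelOf β₀) →
        a * lam * √((modelSize (modelOf β₀) - modelSize M : ℕ) : ℝ) ≤ ∑ i, u i * ε i := by
  obtain ⟨v, hv, horth⟩ := exists_orthogonal_residual X β₀ (modelSpace M)
  have hlt := lt_sum_sq_of_lt_klGap hM hgap hv
  set m := modelSize (modelOf β₀) - modelSize M with hm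
  have hsize : (modelSize (modelOf β₀) : ℝ) = modelSize M + m := by
    rw [hm, Nat.cast_sub hM.modelSize_lt.le]
    ring
  set γ := β₀ - v with hγ
  have hXγ : ∀ i, X.mulVec γ i = X.mulVec β₀ i - X.mulVec v i := by
    intro i
    rw [hγ, Matrix.mulVec_sub, Pi.sub_apply]
  simp_rw [← hXγ] at hlt horth
  set G := ∑ i, X.mulVec γ i ^ 2 with hG
  have hGpos : 0 < G := lt_of_le_of_lt (by positivity) hlt
  set s := √G with hs
  have hspos : 0 < s := Real.sqrt_pos.2 hGpos
  have hss : s ^ 2 = G := Real.sq_sqrt hGpos.le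
  -- The normalized part of the signal that `M` cannot fit, with a minus sign because the noise has
  -- to cancel it.
  refine ⟨fun i => -(X.mulVec γ i) / s, ?_, ?_⟩
  · simp_rw [div_pow, neg_sq]
    rw [← Finset.sum_div, hss, ← hG, div_self hGpos.ne']
  intro ε M' bM bT hM' hbM hbT hcrit
  have hsz : modelSize M' = modelSize M := by unfold modelSize; rw [hM']
  rw [hsz, hsize] at hcrit
  have hsq := sq_sum_le_of_loss (γ := γ) (D := lam ^ 2 * m) (hM'.trans_le (le_of_lt hM)) hbM hbT
    (sub_mem (mem_modelSpace_modelOf β₀) (le_of_lt hM hv)) (by rw [hM']; exact horth) hGpos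
    (by linarith)
  set q := √(m : ℝ) with hq
  have hq0 : 0 ≤ q := Real.sqrt_nonneg _
  have hqq : q ^ 2 = m := Real.sq_sqrt (Nat.cast_nonneg _)
  have hdecomp : ∑ i, X.mulVec γ i * (X.mulVec β₀ i + ε i) = s ^ 2 + ∑ i, X.mulVec γ i * ε i := by
    have h1 : ∀ i, X.mulVec γ i * (X.mulVec β₀ i + ε i) =
        X.mulVec γ i ^ 2 + X.mulVec γ i * X.mulVec v i + X.mulVec γ i * ε i := by
      intro i
      rw [hXγ]
      ring
    simp_rw [h1]
    rw [Finset.sum_add_distrib, Finset.sum_add_distrib, horth v hv, hss, add_zero]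
  rw [hdecomp, ← hG, ← hss, ← hqq, ← mul_pow, ← mul_pow] at hsq
  have h2 := (abs_le_of_sq_le_sq' hsq (by positivity)).2
  have h3 : 2 * (1 + a) * lam * q < s := by
    refine lt_of_pow_lt_pow_left₀ 2 hspos.le ?_
    rw [hss]
    calc _ = 4 * (1 + a) ^ 2 * lam ^ 2 * q ^ 2 := by ring
      _ < G := by rw [hqq]; exact hlt
  have h4 : ∑ i, -(X.mulVec γ i) / s * ε i = -(∑ i, X.mulVec γ i * ε i) / s := by
    rw [← Finset.sum_neg_distrib, Finset.sum_div]
    exact Finset.sum_congr rfl fun i _ => by ring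
  rw [h4, le_div_iff₀ hspos]
  -- The signal has length `s > 2(1+a)λq`, and at most `λq` of it survives in the response, so the
  -- noise must contribute at least `s - λq`, which is more than required.
  have h5 : 0 ≤ lam * q := by positivity
  have h6 : a * lam * q ≤ s - lam * q := by nlinarith [mul_nonneg ha h5]
  nlinarith [mul_le_mul_of_nonneg_right h6 hspos.le]

end Selection

/-! ### Tail bounds -/

section Tail

variable {n : ℕ} {Ω : Type*} [MeasurableSpace Ω] {μ : Measure Ω} [IsProbabilityMeasure μ]
  {ε : Fin n → Ω → ℝ} {σ : ℝ}

theorem measure_sum_mul_ge_le (hindep : iIndepFun ε μ)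
    (hsub : ∀ i, HasSubgaussianMGF (ε i) ⟨σ ^ 2, sq_nonneg σ⟩ μ) (u : Fin n → ℝ) {t : ℝ}
    (ht : 0 ≤ t) :
    μ {ω | t ≤ ∑ i, u i * ε i ω} ≤
      ENNReal.ofReal (Real.exp (-t ^ 2 / (2 * (σ ^ 2 * ∑ i, u i ^ 2)))) := by
  have hind : iIndepFun (fun i ω => u i * ε i ω) μ :=
    hindep.comp (fun i x => u i * x) fun i => measurable_const_mul (u i)
  have h := HasSubgaussianMGF.measure_ge_le (HasSubgaussianMGF.sum_of_iIndepFun hind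
    (s := Finset.univ) fun i _ => (hsub i).const_mul (u i)) ht
  have hc : ((∑ i, NNReal.mk (u i ^ 2) (sq_nonneg (u i)) * NNReal.mk (σ ^ 2) (sq_nonneg σ) :
      NNReal) : ℝ) = σ ^ 2 * ∑ i, u i ^ 2 := by
    rw [NNReal.coe_sum, Finset.mul_sum]
    exact Finset.sum_congr rfl fun i _ => mul_comm _ _
  rw [← ofReal_measureReal, ← hc]
  exact ENNReal.ofReal_le_ofReal h

theorem measure_abs_sum_mul_gt_le (hindep : iIndepFun ε μ)
    (hsub : ∀ i, HasSubgaussianMGF (ε i) ⟨σ ^ 2, sq_nonneg σ⟩ μ) (u : Fin n → ℝ) {t : ℝ}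
    (ht : 0 ≤ t) :
    μ {ω | t < |∑ i, u i * ε i ω|} ≤
      ENNReal.ofReal (2 * Real.exp (-t ^ 2 / (2 * (σ ^ 2 * ∑ i, u i ^ 2)))) := by
  have hsubset : {ω | t < |∑ i, u i * ε i ω|} ⊆
      {ω | t ≤ ∑ i, u i * ε i ω} ∪ {ω | t ≤ ∑ i, -u i * ε i ω} := by
    intro ω hω
    rcases lt_abs.1 (show t < |∑ i, u i * ε i ω| from hω) with h | h
    · exact Or.inl h.le
    · refine Or.inr ?_
      simp only [Set.mem_ofPred_eq, neg_mul, Finset.sum_neg_distrib]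
      exact h.le
  refine (measure_mono hsubset).trans ((measure_union_le _ _).trans ?_)
  have h1 := measure_sum_mul_ge_le hindep hsub u ht
  have h2 := measure_sum_mul_ge_le hindep hsub (fun i => -u i) ht
  simp_rw [neg_sq] at h2
  rw [two_mul, ENNReal.ofReal_add (Real.exp_pos _).le (Real.exp_pos _).le]
  exact add_le_add h1 h2

theorem measure_exists_noise_gt_le {r : ℕ} {p : Fin (r + 1) → ℕ} {X : Matrix (Fin n) (Coord p) ℝ}
    (hX : ∀ c, ∃ i, X i c ≠ 0) (hindep : iIndepFun ε μ)
    (hsub : ∀ i, HasSubgaussianMGF (ε i) ⟨σ ^ 2, sq_nonneg σ⟩ μ) {s : ℝ} (hs : 0 ≤ s) :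
    μ {ω | ∃ c, s * weight X c < |X.transpose.mulVec (fun i => ε i ω) c|} ≤
      ENNReal.ofReal (Fintype.card (Coord p) * (2 * Real.exp (-(s ^ 2 / (2 * σ ^ 2))))) := by
  rw [Set.ofPred_exists]
  refine (measure_iUnion_fintype_le μ _).trans ?_
  have hbound : ∀ c, μ {ω | s * weight X c < |X.transpose.mulVec (fun i => ε i ω) c|} ≤
      ENNReal.ofReal (2 * Real.exp (-(s ^ 2 / (2 * σ ^ 2)))) := by
    intro c
    have hw := weight_pos (hX c)
    have h := measure_abs_sum_mul_gt_le hindep hsub (fun i => X i c)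
      (mul_nonneg hs hw.le : 0 ≤ s * weight X c)
    have he : -(s * weight X c) ^ 2 / (2 * (σ ^ 2 * ∑ i, X i c ^ 2)) =
        -(s ^ 2 / (2 * σ ^ 2)) := by
      rw [← weight_sq, mul_pow, ← neg_mul, ← mul_assoc,
        mul_div_mul_right _ _ (pow_ne_zero 2 hw.ne'), neg_div]
    rw [he] at h
    exact h
  refine (Finset.sum_le_sum fun c _ => hbound c).trans ?_
  rw [Finset.sum_const, Finset.card_univ, nsmul_eq_mul, ENNReal.ofReal_mul (Nat.cast_nonneg _),
    ENNReal.ofReal_natCast]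

end Tail

/-! ### Counting the strict submodels -/

section Counting

variable {r : ℕ} {p : Fin (r + 1) → ℕ}

/-- The coefficient of a level as a linear functional. -/
def coefFunctional (k : Fin (r + 1)) (i : Fin (p k + 1)) : (Coord p → ℝ) →ₗ[ℝ] ℝ where
  toFun β := coef β k i
  map_add' x y := by
    unfold coef
    split <;> simp
  map_smul' c x := by
    unfold coef
    split <;> simp

open Classical in
/-- The functionals on the space of a model that send `β` to `coef β 0 i` for a level `i` of the
first factor, and to `coef β k i + coef β 0 0` for a level of another factor. -/
def levelFunctional (T : Model p) (q : (k : Fin (r + 1)) × Fin (p k + 1)) :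
    Module.Dual ℝ (modelSpace T) :=
  (coefFunctional q.1 q.2 + if q.1 = 0 then 0 else coefFunctional 0 0) ∘ₗ (modelSpace T).subtype

theorem levelFunctional_apply_zero (T : Model p) (i : Fin (p 0 + 1)) (x : modelSpace T) :
    levelFunctional T ⟨0, i⟩ x = coef x.1 0 i := by
  simp [levelFunctional, coefFunctional]

theorem levelFunctional_apply_of_ne (T : Model p) {k : Fin (r + 1)} (hk : k ≠ 0)
    (i : Fin (p k + 1)) (x : modelSpace T) :
    levelFunctional T ⟨k, i⟩ x = coef x.1 k i + coef x.1 0 0 := by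
  simp [levelFunctional, coefFunctional, hk]

theorem levelFunctional_sub_apply (T : Model p) (k : Fin (r + 1)) (i j : Fin (p k + 1))
    (x : modelSpace T) :
    levelFunctional T ⟨k, i⟩ x - levelFunctional T ⟨k, j⟩ x = coef x.1 k i - coef x.1 k j := by
  by_cases hk : k = 0
  · subst hk
    rw [levelFunctional_apply_zero, levelFunctional_apply_zero]
  · rw [levelFunctional_apply_of_ne T hk, levelFunctional_apply_of_ne T hk]
    ring

theorem levelFunctional_eq_of_rel {T : Model p} {k : Fin (r + 1)} {i j : Fin (p k + 1)}
    (h : T k i j) : levelFunctional T ⟨k, i⟩ = levelFunctional T ⟨k, j⟩ := by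
  ext x
  rw [← sub_eq_zero, levelFunctional_sub_apply, sub_eq_zero]
  exact x.2 k i j h

theorem coef_reference (β : Coord p → ℝ) {k : Fin (r + 1)} (hk : k ≠ 0) : coef β k 0 = 0 := by
  simp [coef, hk]

/-- The purpose of adding the intercept: all reference levels share one functional, while
differences within a factor are unchanged. This keeps the number of distinct functionals at most
`|T|`. -/
theorem levelFunctional_reference (T : Model p) (k : Fin (r + 1)) :
    levelFunctional T ⟨k, 0⟩ = levelFunctional T ⟨0, 0⟩ := by
  by_cases hk : k = 0
  · subst hk; rfl
  · ext x
    rw [levelFunctional_apply_of_ne T hk, levelFunctional_apply_zero, coef_reference _ hk, zero_add]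

-- Any values on levels that are constant on clusters and agree on all reference levels are attained
-- on `L_T`; the indicator of one functional is such a choice. These vectors act as a dual family
-- and prove linear independence.
open Classical in
theorem exists_levelFunctional_dual (T : Model p) (φ : Module.Dual ℝ (modelSpace T)) :
    ∃ x : modelSpace T, ∀ q, levelFunctional T q x = if levelFunctional T q = φ then 1 else 0 := by
  set g : (k : Fin (r + 1)) × Fin (p k + 1) → ℝ :=
    fun q => if levelFunctional T q = φ then 1 else 0 with hg
  have hgT : ∀ k i j, T k i j → g ⟨k, i⟩ = g ⟨k, j⟩ := by
    intro k i j hij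
    simp only [hg, levelFunctional_eq_of_rel hij]
  have hgref : ∀ k, g ⟨k, 0⟩ = g ⟨0, 0⟩ := by
    intro k
    simp only [hg, levelFunctional_reference T k]
  set β : Coord p → ℝ := fun c => g c.1 - if c.1.1 = 0 then 0 else g ⟨0, 0⟩ with hβ
  have hcoef0 : ∀ i, coef β 0 i = g ⟨0, i⟩ := by
    intro i
    simp [coef, hβ]
  have hcoef : ∀ k, k ≠ 0 → ∀ i, coef β k i = g ⟨k, i⟩ - g ⟨0, 0⟩ := by
    intro k hk i
    by_cases hi : i = 0
    · subst hi
      rw [coef_reference _ hk, hgref, sub_self]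
    · simp [coef, hβ, hk, hi]
  have hmem : β ∈ modelSpace T := by
    intro k i j hij
    by_cases hk : k = 0
    · subst hk
      rw [hcoef0, hcoef0, hgT _ _ _ hij]
    · rw [hcoef k hk, hcoef k hk, hgT _ _ _ hij]
  refine ⟨⟨β, hmem⟩, ?_⟩
  rintro ⟨k, i⟩
  change _ = g ⟨k, i⟩
  by_cases hk : k = 0
  · subst hk
    rw [levelFunctional_apply_zero, hcoef0]
  · rw [levelFunctional_apply_of_ne T hk, hcoef k hk, hcoef0]
    ring

theorem linearIndependent_range_levelFunctional (T : Model p) :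
    LinearIndependent ℝ ((↑) : Set.range (levelFunctional T) → Module.Dual ℝ (modelSpace T)) := by
  classical
  rw [linearIndependent_iff']
  intro s g hsum φ hφ
  obtain ⟨x, hx⟩ := exists_levelFunctional_dual T φ
  have h1 := congrArg (fun ψ : Module.Dual ℝ (modelSpace T) => ψ x) hsum
  simp only [LinearMap.sum_apply, LinearMap.smul_apply, LinearMap.zero_apply] at h1
  rw [Finset.sum_eq_single φ] at h1
  · obtain ⟨_, q, rfl⟩ := φ
    simpa [hx] using h1
  · rintro ⟨_, q, rfl⟩ _ hne
    have hne' : levelFunctional T q ≠ φ := fun h => hne (Subtype.ext h)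
    simp [hx, hne']
  · exact fun h => absurd hφ h

theorem card_range_levelFunctional_le (T : Model p) :
    Nat.card (Set.range (levelFunctional T)) ≤ modelSize T := by
  classical
  rw [Nat.card_eq_fintype_card, modelSize, ← Subspace.dual_finrank_eq]
  exact (linearIndependent_range_levelFunctional T).fintype_card_le_finrank

theorem two_mul_card_lt_pairs_le (N : ℕ) :
    2 * Fintype.card {q : Fin N × Fin N // q.1 < q.2} ≤ N ^ 2 := by
  have h1 : Fintype.card {q : Fin N × Fin N // q.1 < q.2} =
      Finset.card {q : Fin N × Fin N | q.1 < q.2} := Fintype.card_subtype _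
  have h2 : Finset.card {q : Fin N × Fin N | q.1 < q.2} =
      Finset.card {q : Fin N × Fin N | q.2 < q.1} :=
    Finset.card_bij (fun q _ => q.swap) (by simp) (by simp) fun q hq => ⟨q.swap, by simpa using hq⟩
  have h3 : Disjoint ({q : Fin N × Fin N | q.1 < q.2} : Finset _)
      ({q : Fin N × Fin N | q.2 < q.1} : Finset _) := by
    rw [Finset.disjoint_filter]
    exact fun q _ h => h.asymm
  have h4 := Finset.card_le_univ (({q : Fin N × Fin N | q.1 < q.2} : Finset _) ∪
    ({q : Fin N × Fin N | q.2 < q.1} : Finset _))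
  rw [Finset.card_union_of_disjoint h3, ← h2, Fintype.card_prod, Fintype.card_fin] at h4
  rw [h1, sq]
  omega

/-- A subspace that is cut out by some of finitely many functionals is cut out by linearly
independent ones, so by as many of them as its codimension. -/
theorem exists_finset_functionals {V ι : Type*} [AddCommGroup V] [Module ℝ V]
    [FiniteDimensional ℝ V] [Fintype ι] (f : ι → Module.Dual ℝ V) (K : Submodule ℝ V) (E : Set ι)
    (hK : ∀ x, x ∈ K ↔ ∀ i ∈ E, f i x = 0) :
    ∃ D : Finset ι, (∀ x, x ∈ K ↔ ∀ i ∈ D, f i x = 0) ∧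
      D.card + Module.finrank ℝ K = Module.finrank ℝ V := by
  classical
  obtain ⟨κ, e, he, hspan, hli⟩ := exists_linearIndependent' ℝ (fun i : E => f i)
  have : Fintype κ := Fintype.ofInjective e he
  have hco : ∀ {α : Type _} (g : α → Module.Dual ℝ V) (x : V),
      x ∈ (Submodule.span ℝ (Set.range g)).dualCoannihilator ↔ ∀ i, g i x = 0 := by
    intro α g x
    rw [Submodule.mem_dualCoannihilator]
    constructor
    · exact fun h i => h _ (Submodule.subset_span ⟨i, rfl⟩)
    · intro h φ hφ
      induction hφ using Submodule.span_induction with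
      | mem φ hφ => obtain ⟨i, rfl⟩ := hφ; exact h i
      | zero => rfl
      | add φ ψ _ _ h1 h2 => rw [LinearMap.add_apply, h1, h2, add_zero]
      | smul c φ _ h1 => rw [LinearMap.smul_apply, h1, smul_zero]
  have hKE : K = (Submodule.span ℝ (Set.range fun i : E => f i)).dualCoannihilator := by
    ext x
    rw [hco, hK, Subtype.forall]
  have hinj : Function.Injective fun c => (e c : ι) := Subtype.val_injective.comp he
  refine ⟨Finset.univ.image fun c => (e c : ι), fun x => ?_, ?_⟩
  · rw [hKE, ← hspan, hco]
    simp
  · rw [Finset.card_image_of_injective _ hinj, Finset.card_univ, hKE, ← hspan,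
      ← finrank_span_eq_card hli]
    exact Subspace.finrank_add_finrank_dualCoannihilator_eq _

/-- The submodels of `T` are labelled by subsets of a set with at most `|T|² / 2` elements, in such
a way that the label determines the space of the model and its cardinality is the codimension. -/
theorem exists_submodel_labels (T : Model p) :
    ∃ (N : ℕ) (label : Model p → Finset {q : Fin N × Fin N // q.1 < q.2}),
      N ≤ modelSize T ∧
      (∀ M, modelSpace M ≤ modelSpace T → (label M).card + modelSize M = modelSize T) ∧
      ∀ M M', modelSpace M ≤ modelSpace T → modelSpace M' ≤ modelSpace T →
        label M = label M' → modelSpace M = modelSpace M' := by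
  classical
  let e : Fin (Nat.card (Set.range (levelFunctional T))) ≃ Set.range (levelFunctional T) :=
    (Finite.equivFin _).symm
  let f : {q : Fin (Nat.card (Set.range (levelFunctional T))) ×
      Fin (Nat.card (Set.range (levelFunctional T))) // q.1 < q.2} →
      Module.Dual ℝ (modelSpace T) := fun q => (e q.1.1).1 - (e q.1.2).1
  have key : ∀ M : Model p, ∃ D : Finset {q : Fin (Nat.card (Set.range (levelFunctional T))) ×
      Fin (Nat.card (Set.range (levelFunctional T))) // q.1 < q.2}, modelSpace M ≤ modelSpace T →
      (∀ x : modelSpace T, (x : Coord p → ℝ) ∈ modelSpace M ↔ ∀ i ∈ D, f i x = 0) ∧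
        D.card + modelSize M = modelSize T := by
    intro M
    by_cases hM : modelSpace M ≤ modelSpace T
    swap
    · exact ⟨∅, fun h => absurd h hM⟩
    obtain ⟨D, hD, hcard⟩ := exists_finset_functionals f
      ((modelSpace M).comap (modelSpace T).subtype)
      -- All pair differences vanishing on `L_M`. They cut out `L_M` because every merging
      -- constraint is, up to sign, such a difference or trivial.
      {i | ∀ x : modelSpace T, (x : Coord p → ℝ) ∈ modelSpace M → f i x = 0} (by
        intro x
        constructor
        · exact fun hx i hi => hi x hx
        · intro hx k i j hij
          rw [← sub_eq_zero, Submodule.subtype_apply, ← levelFunctional_sub_apply T k i j x]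
          obtain ⟨s, hs⟩ := e.surjective ⟨levelFunctional T ⟨k, i⟩, _, rfl⟩
          obtain ⟨t, ht⟩ := e.surjective ⟨levelFunctional T ⟨k, j⟩, _, rfl⟩
          have hvan : ∀ y : modelSpace T, (y : Coord p → ℝ) ∈ modelSpace M →
              (e s).1 y - (e t).1 y = 0 := by
            intro y hy
            rw [hs, ht, levelFunctional_sub_apply, sub_eq_zero]
            exact hy k i j hij
          have hgoal : (e s).1 x - (e t).1 x = 0 := by
            rcases lt_trichotomy s t with hst | hst | hst
            · exact hx ⟨(s, t), hst⟩ hvan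
            · rw [hst, sub_self]
            · rw [← neg_sub, neg_eq_zero]
              refine hx ⟨(t, s), hst⟩ fun y hy => ?_
              have := hvan y hy
              rw [← neg_sub, neg_eq_zero] at this
              exact this
          rw [hs, ht] at hgoal
          exact hgoal)
    refine ⟨D, fun _ => ⟨hD, ?_⟩⟩
    rw [(Submodule.comapSubtypeEquivOfLe hM).finrank_eq] at hcard
    exact hcard
  choose label hlabel using key
  refine ⟨_, label, card_range_levelFunctional_le T, fun M hM => (hlabel M hM).2, ?_⟩
  intro M M' hM hM' heq
  ext β
  constructor
  · intro hβ
    rw [(hlabel M' hM').1 ⟨β, hM hβ⟩, ← heq]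
    exact ((hlabel M hM).1 ⟨β, hM hβ⟩).1 hβ
  · intro hβ
    rw [(hlabel M hM).1 ⟨β, hM' hβ⟩, heq]
    exact ((hlabel M' hM').1 ⟨β, hM' hβ⟩).1 hβ

theorem card_coord (p : Fin (r + 1) → ℕ) :
    (Fintype.card (Coord p) : ℝ) = 1 + ∑ k, (p k : ℝ) := by
  classical
  have h1 : Fintype.card (Coord p) =
      ∑ k, Finset.card {j : Fin (p k + 1) | k = 0 ∨ j ≠ 0} := by
    rw [Fintype.card_subtype, ← Finset.card_sigma]
    congr 1
    ext ⟨k, j⟩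
    simp
  have h2 : ∀ k : Fin (r + 1), Finset.card {j : Fin (p k + 1) | k = 0 ∨ j ≠ 0} =
      p k + if k = 0 then 1 else 0 := by
    intro k
    by_cases hk : k = 0
    · simp [hk]
    · simp [hk, Finset.filter_ne']
  rw [h1]
  simp_rw [h2]
  rw [Finset.sum_add_distrib]
  push_cast
  simp [add_comm]

/-- With `x = |ι| q` the sum is `(1 + q) ^ |ι| - 1 ≤ exp x - 1`. On `[0, log 2]` the convex
exponential lies below its chord, of slope `1 / log 2 ≤ 2`; this is the origin of `log 2` in the
lower bound on `λ²`. -/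
theorem sum_nonempty_pow_card_le {ι : Type*} [Fintype ι] [DecidableEq ι] {q : ℝ} (hq : 0 ≤ q)
    (h : Fintype.card ι * q ≤ Real.log 2) :
    ∑ D : Finset ι with D.Nonempty, q ^ D.card ≤ 2 * (Fintype.card ι * q) := by
  have h1 : ∑ D : Finset ι, q ^ D.card = (q + 1) ^ Fintype.card ι := by
    simpa using Fintype.sum_pow_mul_eq_add_pow ι q 1
  have h2 : ∑ D : Finset ι with D.Nonempty, q ^ D.card = (q + 1) ^ Fintype.card ι - 1 := by
    rw [← h1, ← Finset.sum_filter_add_sum_filter_not Finset.univ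
      (fun D : Finset ι => D.Nonempty) fun D => q ^ D.card]
    simp [Finset.not_nonempty_iff_eq_empty, Finset.filter_eq']
  set x := Fintype.card ι * q with hx
  have hx0 : 0 ≤ x := by positivity
  have h3 : (q + 1) ^ Fintype.card ι ≤ Real.exp x := by
    rw [hx, Real.exp_nat_mul]
    exact pow_le_pow_left₀ (by positivity) (Real.add_one_le_exp q) _
  have hlog : (1 : ℝ) / 2 ≤ Real.log 2 := by linarith [Real.log_two_gt_d9]
  have hlogpos : 0 < Real.log 2 := by linarith
  have h4 : Real.exp x ≤ 1 + x / Real.log 2 := by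
    have hconv := convexOn_exp.2 (Set.mem_univ 0) (Set.mem_univ (Real.log 2))
      (show 0 ≤ 1 - x / Real.log 2 by rw [sub_nonneg, div_le_one hlogpos]; exact h)
      (show 0 ≤ x / Real.log 2 by positivity) (by ring)
    simp only [smul_eq_mul, mul_zero, zero_add, Real.exp_zero, mul_one,
      Real.exp_log (by norm_num : (0 : ℝ) < 2)] at hconv
    rw [div_mul_cancel₀ _ hlogpos.ne'] at hconv
    linarith
  have h5 : x / Real.log 2 ≤ 2 * x := by
    rw [div_le_iff₀ hlogpos]
    nlinarith
  linarith

end Counting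

/-! ### Union bound over the strict submodels -/

section Union

variable {r n : ℕ} {p : Fin (r + 1) → ℕ} {X : Matrix (Fin n) (Coord p) ℝ} {β₀ : Coord p → ℝ}
  {Ω : Type*} [MeasurableSpace Ω] {μ : Measure Ω} [IsProbabilityMeasure μ]
  {ε : Fin n → Ω → ℝ} {σ lam a : ℝ}

/-- `M` is a strict submodel of the model of `β₀`, and for the data with noise `e` its information
criterion is at most that of the model of `β₀`. -/
def Preferred (X : Matrix (Fin n) (Coord p) ℝ) (β₀ : Coord p → ℝ) (lam : ℝ) (M : Model p)
    (e : Fin n → ℝ) : Prop :=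
  StrictSubmodel M (modelOf β₀) ∧ ∃ bM bT,
    IsConstrainedEstimator X (fun i => X.mulVec β₀ i + e i) M bM ∧
    IsConstrainedEstimator X (fun i => X.mulVec β₀ i + e i) (modelOf β₀) bT ∧
    loss X (fun i => X.mulVec β₀ i + e i) bM + lam ^ 2 / 2 * modelSize M ≤
      loss X (fun i => X.mulVec β₀ i + e i) bT + lam ^ 2 / 2 * modelSize (modelOf β₀)

/-- When the noise is dominated by the penalty, the true model belongs to the nested family, so PDMR
can select a strict submodel only if the criterion does not prefer the true model to it. -/
theorem IsPDMROutput.preferred {M : Model p} {e : Fin n → ℝ}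
    (H : IsPDMROutput X (fun i => X.mulVec β₀ i + e i) lam M)
    (hM : StrictSubmodel M (modelOf β₀)) (hX : ∀ c, ∃ i, X i c ≠ 0) (hlam : 0 < lam) (ha : 0 < a)
    (he : ∀ c, |X.transpose.mulVec e c| ≤ a * lam * weight X c)
    (hgap : ENNReal.ofReal (lam ^ 2) * ENNReal.ofReal (16 * (1 + a) ^ 2) <
      minGap β₀ ^ 2 * cif X β₀ a ^ 2) :
    Preferred X β₀ lam M e := by
  obtain ⟨β, F, b, hβ, hF, hb, hMF, hmin⟩ := H
  have hT : modelOf β₀ ∈ F :=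
    hF.mem_of_threshold (τ := 2 * ‖β - β₀‖) (by positivity)
      (modelOf_iff_of_four_mul_norm_lt fun _ _ _ hij =>
        hβ.four_mul_norm_lt hlam ha hX he hgap hij)
  exact ⟨hM, _, _, hb M hMF, hb _ hT, hmin _ hT⟩

/-- All models with one label share their space and hence the direction from `exists_direction`, so
a single tail event covers them. Its threshold `aλ√m` turns the tail into the `m`-th power. -/
theorem measure_exists_preferred_label_le {ι : Type*} {label : Model p → Finset ι}
    (hcard : ∀ M, modelSpace M ≤ modelSpace (modelOf β₀) →
      (label M).card + modelSize M = modelSize (modelOf β₀))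
    (hinj : ∀ M M', modelSpace M ≤ modelSpace (modelOf β₀) →
      modelSpace M' ≤ modelSpace (modelOf β₀) → label M = label M' → modelSpace M = modelSpace M')
    (hindep : iIndepFun ε μ) (hsub : ∀ i, HasSubgaussianMGF (ε i) ⟨σ ^ 2, sq_nonneg σ⟩ μ)
    (hlam : 0 ≤ lam) (ha : 0 ≤ a)
    (hgap : ENNReal.ofReal (lam ^ 2) * ENNReal.ofReal (16 * (1 + a) ^ 2) < 4 * klGap X β₀)
    (D : Finset ι) :
    μ {ω | ∃ M, label M = D ∧ Preferred X β₀ lam M (fun i => ε i ω)} ≤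
      ENNReal.ofReal (Real.exp (-(a ^ 2 * lam ^ 2 / (2 * σ ^ 2))) ^ D.card) := by
  by_cases hD : ∃ M, label M = D ∧ StrictSubmodel M (modelOf β₀)
  swap
  · have hempty : {ω | ∃ M, label M = D ∧ Preferred X β₀ lam M (fun i => ε i ω)} = ∅ := by
      ext ω
      simp only [Set.mem_ofPred_eq, Set.mem_empty_iff_false, iff_false]
      rintro ⟨M, hM, hpref⟩
      exact hD ⟨M, hM, hpref.1⟩
    rw [hempty, measure_empty]
    exact zero_le
  obtain ⟨M₀, rfl, hM₀⟩ := hD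
  obtain ⟨u, hu, hdev⟩ := exists_direction hM₀ ha hlam hgap
  have hm : modelSize (modelOf β₀) - modelSize M₀ = (label M₀).card := by
    rw [← hcard M₀ (le_of_lt hM₀), Nat.add_sub_cancel]
  rw [hm] at hdev
  have hsubset : {ω | ∃ M, label M = label M₀ ∧ Preferred X β₀ lam M (fun i => ε i ω)} ⊆
      {ω | a * lam * √((label M₀).card : ℝ) ≤ ∑ i, u i * ε i ω} := by
    rintro ω ⟨M, hM, hstrict, bM, bT, hbM, hbT, hcrit⟩
    exact hdev _ M bM bT (hinj M M₀ (le_of_lt hstrict) (le_of_lt hM₀) hM) hbM hbT hcrit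
  refine (measure_mono hsubset).trans ((measure_sum_mul_ge_le hindep hsub u (by positivity)).trans
    (le_of_eq ?_))
  rw [hu, ← Real.exp_nat_mul, mul_pow, Real.sq_sqrt (Nat.cast_nonneg _)]
  congr 2
  ring

theorem measure_exists_preferred_le (hindep : iIndepFun ε μ)
    (hsub : ∀ i, HasSubgaussianMGF (ε i) ⟨σ ^ 2, sq_nonneg σ⟩ μ) (hσ : 0 < σ)
    (hlam : 0 ≤ lam) (ha : 0 < a)
    (hlower : 2 * a⁻¹ ^ 2 * σ ^ 2 *
      Real.log ((modelSize (modelOf β₀) : ℝ) ^ 2 / (2 * Real.log 2)) ≤ lam ^ 2)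
    (hgap : ENNReal.ofReal (lam ^ 2) * ENNReal.ofReal (16 * (1 + a) ^ 2) < 4 * klGap X β₀) :
    μ {ω | ∃ M, Preferred X β₀ lam M (fun i => ε i ω)} ≤
      ENNReal.ofReal ((modelSize (modelOf β₀) : ℝ) ^ 2 *
        Real.exp (-(a ^ 2 * lam ^ 2 / (2 * σ ^ 2)))) := by
  classical
  obtain ⟨N, label, hN, hcard, hinj⟩ := exists_submodel_labels (modelOf β₀)
  set m := modelSize (modelOf β₀) with hm
  set E := a ^ 2 * lam ^ 2 / (2 * σ ^ 2) with hE
  set q := Real.exp (-E) with hq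
  have hq0 : 0 < q := Real.exp_pos _
  have hlog2 : 0 < Real.log 2 := Real.log_pos one_lt_two
  have hlogE : Real.log ((m : ℝ) ^ 2 / (2 * Real.log 2)) ≤ E := by
    rw [hE, le_div_iff₀ (by positivity)]
    have h1 := mul_le_mul_of_nonneg_left hlower (sq_nonneg a)
    have h2 : a ^ 2 * (2 * a⁻¹ ^ 2 * σ ^ 2 * Real.log ((m : ℝ) ^ 2 / (2 * Real.log 2))) =
        Real.log ((m : ℝ) ^ 2 / (2 * Real.log 2)) * (2 * σ ^ 2) := by
      field_simp
    rwa [h2] at h1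
  have hmq : (m : ℝ) ^ 2 * q ≤ 2 * Real.log 2 := by
    -- `x ≤ exp (log x)` holds for every real `x`, so `m > 0` need not be shown.
    have h1 := (Real.le_exp_log _).trans (Real.exp_le_exp.2 hlogE)
    rw [div_le_iff₀ (by positivity)] at h1
    calc (m : ℝ) ^ 2 * q ≤ Real.exp E * (2 * Real.log 2) * q :=
          mul_le_mul_of_nonneg_right h1 hq0.le
      _ = 2 * Real.log 2 * (Real.exp E * Real.exp (-E)) := by rw [hq]; ring
      _ = 2 * Real.log 2 := by rw [← Real.exp_add, add_neg_cancel, Real.exp_zero, mul_one]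
  have hpairs : 2 * (Fintype.card {q : Fin N × Fin N // q.1 < q.2} : ℝ) ≤ (m : ℝ) ^ 2 := by
    have h1 := (two_mul_card_lt_pairs_le N).trans (Nat.pow_le_pow_left hN 2)
    exact_mod_cast h1
  have hpairsq := mul_le_mul_of_nonneg_right hpairs hq0.le
  have hsubset : {ω | ∃ M, Preferred X β₀ lam M (fun i => ε i ω)} ⊆
      ⋃ D ∈ (Finset.univ.filter Finset.Nonempty : Finset (Finset {q : Fin N × Fin N // q.1 < q.2})),
        {ω | ∃ M, label M = D ∧ Preferred X β₀ lam M (fun i => ε i ω)} := by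
    rintro ω ⟨M, hM⟩
    simp only [Set.mem_iUnion]
    refine ⟨label M, ?_, M, rfl, hM⟩
    have h1 := hcard M (le_of_lt hM.1)
    have h2 := hM.1.modelSize_lt
    rw [Finset.mem_filter, ← Finset.card_pos]
    exact ⟨Finset.mem_univ _, by omega⟩
  refine (measure_mono hsubset).trans ((measure_biUnion_finset_le _ _).trans ?_)
  refine (Finset.sum_le_sum fun D _ => measure_exists_preferred_label_le hcard hinj hindep hsub
    hlam ha.le hgap D).trans ?_
  rw [← ENNReal.ofReal_sum_of_nonneg fun _ _ => by positivity]
  refine ENNReal.ofReal_le_ofReal ((sum_nonempty_pow_card_le hq0.le ?_).trans ?_) <;> linarith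

end Union

end PDMR

theorem theorem1 {r n : ℕ} (p : Fin (r + 1) → ℕ)
    (X : Matrix (Fin n) (PDMR.Coord p) ℝ) (hX : ∀ c, ∃ i, X i c ≠ 0)
    (β₀ : PDMR.Coord p → ℝ)
    {Ω : Type*} [MeasurableSpace Ω] (μ : Measure Ω) [IsProbabilityMeasure μ]
    (ε : Fin n → Ω → ℝ) (hindep : iIndepFun ε μ)
    (σ : ℝ) (hσ : 0 < σ)
    (hsub : ∀ i, HasSubgaussianMGF (ε i) ⟨σ ^ 2, sq_nonneg σ⟩ μ)
    (lam : ℝ) (hlam : 0 ≤ lam)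
    (Mhat : Ω → PDMR.Model p)
    (hMhat : ∀ ω, PDMR.IsPDMROutput X (fun i => X.mulVec β₀ i + ε i ω) lam (Mhat ω))
    (a : ℝ) (ha₀ : 0 < a) (ha₁ : a < 1)
    (hlower : 2 * a⁻¹ ^ 2 * σ ^ 2 *
        Real.log ((PDMR.modelSize (PDMR.modelOf β₀) : ℝ) ^ 2 / (2 * Real.log 2)) ≤ lam ^ 2)
    (hupper : ENNReal.ofReal (lam ^ 2) <
      min (PDMR.minGap β₀ ^ 2 * PDMR.cif X β₀ a ^ 2) (4 * PDMR.klGap X β₀) /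
        ENNReal.ofReal (16 * (1 + a) ^ 2)) :
    μ {ω | PDMR.StrictSubmodel (Mhat ω) (PDMR.modelOf β₀)} ≤
      ENNReal.ofReal
        ((2 * (1 + ∑ k, (p k : ℝ)) + (PDMR.modelSize (PDMR.modelOf β₀) : ℝ) ^ 2) *
          Real.exp (-(a ^ 2 * lam ^ 2 / (2 * σ ^ 2)))) := by
  -- For `λ = 0` the Lasso argument, which divides by `λ`, is unavailable, but the claimed bound is
  -- at least `2`.
  rcases hlam.eq_or_lt with rfl | hpos
  · refine prob_le_one.trans ?_
    rw [← ENNReal.ofReal_one]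
    refine ENNReal.ofReal_le_ofReal ?_
    have h1 : (0 : ℝ) ≤ ∑ k, (p k : ℝ) := Finset.sum_nonneg fun _ _ => Nat.cast_nonneg _
    have h2 := sq_nonneg (PDMR.modelSize (PDMR.modelOf β₀) : ℝ)
    simp only [ne_eq, OfNat.ofNat_ne_zero, not_false_eq_true, zero_pow, mul_zero, zero_div,
      neg_zero, Real.exp_zero, mul_one]
    linarith
  rw [ENNReal.lt_div_iff_mul_lt (Or.inl (by simp; positivity)) (Or.inl ENNReal.ofReal_ne_top),
    lt_min_iff] at hupper
  obtain ⟨hgap, hkl⟩ := hupper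
  have hsubset : {ω | PDMR.StrictSubmodel (Mhat ω) (PDMR.modelOf β₀)} ⊆
      {ω | ∃ c, a * lam * PDMR.weight X c < |X.transpose.mulVec (fun i => ε i ω) c|} ∪
        {ω | ∃ M, PDMR.Preferred X β₀ lam M (fun i => ε i ω)} := by
    intro ω hω
    by_cases hA : ∃ c, a * lam * PDMR.weight X c < |X.transpose.mulVec (fun i => ε i ω) c|
    · exact Or.inl hA
    · push Not at hA
      exact Or.inr ⟨Mhat ω, (hMhat ω).preferred hω hX hpos ha₀ hA hgap⟩
  refine (measure_mono hsubset).trans ((measure_union_le _ _).trans ?_)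
  refine (add_le_add
    (PDMR.measure_exists_noise_gt_le hX hindep hsub (by positivity : 0 ≤ a * lam))
    (PDMR.measure_exists_preferred_le hindep hsub hσ hlam ha₀ hlower hkl)).trans ?_
  rw [← ENNReal.ofReal_add (by positivity) (by positivity), PDMR.card_coord, mul_pow]
  refine ENNReal.ofReal_le_ofReal (le_of_eq ?_)
  ring
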